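/- Let $G$ be a simply connected real Lie group, $H\subset G$ a closed connected subgroup, $\mathfrak g,\mathfrak h$ their Lie algebras, and $\mathfrak m\subset\mathfrak g$ a subspace with $\mathfrak g=\mathfrak h\oplus\mathfrak m$, $[\mathfrak h,\mathfrak m]\subset\mathfrak m$ and $[\mathfrak m,\mathfrak m]\subset\mathfrak h$. Let $\omega_0$ be an $\mathrm{ad}(\mathfrak h)$-invariant non-degenerate skew-symmetric bilinear form on $\mathfrak m$ and let $(X_1,\dots,X_{2n})$ be a symplectic basis: $\omega_0(X_j,X_k)=\omega_0(X_{n+j},X_{n+k})=0$ and $\omega_0(X_j,X_{n+k})=\delta_{jk}$ for $1\le j,k\le n$. Let $\kappa:H\to\mathrm{Sp}(\mathfrak m)$, $\kappa(h)=\mathrm{Ad}(h)|_{\mathfrak m}$, be the isotropy representation, let $\tilde\kappa:H\to\mathrm{Mp}(\mathfrak m)$ be a continuous homomorphism lifting $\kappa$ to the metaplectic group, and let $\lambda$ be the unitary representation of $H$ on $L^2(\mathbb R^n)$ obtained by composing $\tilde\kappa$ with the metaplectic representation. Put $M=G/H$, $TM=G\times_\kappa\mathfrak m$ with the symplectic form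 $\omega([g,X],[g,Y])=\omega_0(X,Y)$, and $Q=G\times_\lambda L^2(\mathbb R^n)$ (the symplectic spinor bundle). Sections of $Q$ are viewed as maps $\varphi:G\to L^2(\mathbb R^n)$ with $\varphi(gh)=\lambda(h^{-1})\varphi(g)$; $\Gamma(Q)$ denotes the smooth ones. For $X\in\mathfrak g$ let $$X(\varphi)(g)=\mathrm d\varphi(\mathrm dL_gX)$$ be the derivative along the left-invariant vector field determined by $X$. The canonical connection, whose horizontal space at $g\in G$ is $\mathrm dL_g\mathfrak m$, induces the spinor derivative $\nabla_{[g,X]}\varphi=[g,X(\varphi)(g)]$. The symplectic Clifford multiplication $X\cdot f$ is real linear in $X\in\mathfrak m$ and given by $X_j\cdot f=\mathrm i x_jf$ and $X_{n+j}\cdot f=\partial f/\partial x_j$. For $f\in L^2(\mathbb R^n)$ it is defined as a tempered distribution, and it is regarded as an unbounded operator $\mu_0:\mathfrak m\otimes L^2(\mathbb R^n)\to L^2(\mathbb R^n)$, $X\otimes f\mapsto X\cdot f$, whose domain consists of all tensors with distributional product in $L^2(\mathbb R^n)$. It induces $\mu:TM\otimes Q\to Q$, $\mu([g,X]\otimes[g,f])=[g,X\cdot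 f]$. The first symplectic Dirac operator is $$\mathcal D=\mu\circ(\bar\omega\otimes\mathrm{id}_Q)\circ\nabla ,$$ where $\bar\omega:T^*M\to TM$ is the inverse of $v\mapsto\omega(v,\cdot)$; its domain consists of all $\varphi\in\Gamma(Q)$ such that $(\bar\omega\otimes\mathrm{id}_Q)\nabla\varphi$ lies pointwise in the domain of $\mu$, and $\mathcal D\varphi$ is a section of $Q$. Then for all $\varphi\in\Gamma(Q)$ in the domain of $\mathcal D$ and all $g\in G$, $$(\mathcal D\varphi)(g)=\sum_{j=1}^nX_j\cdot X_{n+j}(\varphi)(g)-\sum_{j=1}^nX_{n+j}\cdot X_j(\varphi)(g),$$ where the individual terms on the right are tempered distributions. If $\varphi\in\Gamma(Q)$ is such that $X_j\cdot X_{n+j}(\varphi)(g)$ and $X_{n+j}\cdot X_j(\varphi)(g)$ are in $L^2(\mathbb R^n)$ for all $g\in G$ and $1\le j\le n$, then $\varphi$ is in the domain of $\mathcal D$ and the formula is an identity in $L^2(\mathbb R^n)$. -/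

import Mathlib

open scoped Manifold ContDiff TensorProduct SchwartzMap LineDeriv

noncomputable section

namespace SymplecticDirac

open MeasureTheory

/-! ### The Hilbert space `L²(ℝⁿ)` and the symplectic Clifford multiplication -/

/-- The Hilbert space `L²(ℝⁿ)` of complex valued functions. -/
abbrev L2 (n : ℕ) : Type :=
  Lp ℂ 2 (volume : Measure (EuclideanSpace ℝ (Fin n)))

/-- The embedding of `L²(ℝⁿ)` into the tempered distributions, `f ↦ (ψ ↦ ∫ ψ f)`. -/
def toDist (n : ℕ) : L2 n →ₗ[ℝ] 𝓢'(EuclideanSpace ℝ (Fin n), ℂ) :=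
  (Lp.toTemperedDistributionCLM ℂ
    (volume : Measure (EuclideanSpace ℝ (Fin n))) 2).toLinearMap.restrictScalars ℝ

theorem toDist_injective (n : ℕ) : Function.Injective (toDist n) := by
  have h := LinearMap.ker_eq_bot.mp (Lp.ker_toTemperedDistributionCLM_eq_bot (F := ℂ)
    (μ := (volume : Measure (EuclideanSpace ℝ (Fin n)))) (p := 2))
  exact fun f g hfg ↦ h hfg

/-- `f ↦ i x_j f`, as a map from `L²(ℝⁿ)` to the tempered distributions. -/
def mulCoord (n : ℕ) (j : Fin n) : L2 n →ₗ[ℝ] 𝓢'(EuclideanSpace ℝ (Fin n), ℂ) :=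
  ((TemperedDistribution.smulLeftCLM ℂ
    (fun x : EuclideanSpace ℝ (Fin n) ↦ Complex.I * ((x j : ℝ) : ℂ))).toLinearMap.restrictScalars ℝ)
    ∘ₗ toDist n

/-- `f ↦ ∂f/∂x_j`, as a map from `L²(ℝⁿ)` to the tempered distributions. -/
def partialDeriv (n : ℕ) (j : Fin n) : L2 n →ₗ[ℝ] 𝓢'(EuclideanSpace ℝ (Fin n), ℂ) :=
  ((LineDeriv.lineDerivOpCLM ℂ 𝓢'(EuclideanSpace ℝ (Fin n), ℂ)
    (EuclideanSpace.single j (1 : ℝ))).toLinearMap.restrictScalars ℝ) ∘ₗ toDist n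

section Clifford

variable {n : ℕ} {V : Type*} [AddCommGroup V] [Module ℝ V]

/-- The symplectic Clifford multiplication `V ⊗ L²(ℝⁿ) → 𝓢'(ℝⁿ)` in the sense of distributions,
with respect to a basis `X_1, …, X_n` (`Sum.inl`), `X_{n+1}, …, X_{2n}` (`Sum.inr`):
`X_j ⊗ f ↦ i x_j f` and `X_{n+j} ⊗ f ↦ ∂f/∂x_j`. -/
def cliffordDist (b : Module.Basis (Fin n ⊕ Fin n) ℝ V) :
    V ⊗[ℝ] L2 n →ₗ[ℝ] 𝓢'(EuclideanSpace ℝ (Fin n), ℂ) :=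
  TensorProduct.lift (b.constr ℝ (Sum.elim (mulCoord n) (partialDeriv n)))

/-- The symplectic Clifford multiplication `μ₀ : V ⊗ L²(ℝⁿ) → L²(ℝⁿ)` as an unbounded operator. Its
domain consists of all `t` whose distributional Clifford product is in `L²(ℝⁿ)`. -/
def clifford (b : Module.Basis (Fin n ⊕ Fin n) ℝ V) : V ⊗[ℝ] L2 n →ₗ.[ℝ] L2 n where
  domain := (LinearMap.range (toDist n)).comap (cliffordDist b)
  toFun := (LinearEquiv.ofInjective (toDist n) (toDist_injective n)).symm.toLinearMap ∘ₗ
    ((cliffordDist b).restrict (fun _ h ↦ h))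

theorem toDist_clifford (b : Module.Basis (Fin n ⊕ Fin n) ℝ V) (t : (clifford b).domain) :
    toDist n (clifford b t) = cliffordDist b t := by
  have h := LinearEquiv.apply_symm_apply (LinearEquiv.ofInjective (toDist n) (toDist_injective n))
    ((cliffordDist b).restrict (p := (LinearMap.range (toDist n)).comap (cliffordDist b))
      (fun _ h ↦ h) t)
  exact congrArg Subtype.val h

theorem mem_graph_clifford (b : Module.Basis (Fin n ⊕ Fin n) ℝ V) (t : V ⊗[ℝ] L2 n) (u : L2 n) :
    (t, u) ∈ (clifford b).graph ↔ cliffordDist b t = toDist n u := by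
  rw [LinearPMap.mem_graph_iff]
  constructor
  · rintro ⟨y, hy, hu⟩
    rw [← show (y : V ⊗[ℝ] L2 n) = t from hy, ← show clifford b y = u from hu, toDist_clifford]
  · intro h
    refine ⟨⟨t, u, h.symm⟩, rfl, toDist_injective n ?_⟩
    exact (toDist_clifford b ⟨t, u, h.symm⟩).trans h

/-! ### The metaplectic group and the metaplectic representation -/

/-- The Weyl operators `W(X) = exp (X · )` of the Schrödinger representation: for
`X = ∑ a_j X_j + ∑ b_j X_{n+j}`, `(W(X) f)(x) = exp (i (a·x + a·b / 2)) f(x + b)`. -/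
def weyl (b : Module.Basis (Fin n ⊕ Fin n) ℝ V) (X : V) (f : L2 n) : L2 n :=
  MemLp.toLp (μ := volume) (p := 2)
    (fun x : EuclideanSpace ℝ (Fin n) ↦
      Complex.exp (((∑ j, b.repr X (Sum.inl j) * x j
        + (∑ j, b.repr X (Sum.inl j) * b.repr X (Sum.inr j)) / 2 : ℝ) : ℂ) * Complex.I)
        * f (x + WithLp.toLp 2 (fun j ↦ b.repr X (Sum.inr j))))
    (by
      have h1 : MemLp (fun x : EuclideanSpace ℝ (Fin n) ↦
          f (x + WithLp.toLp 2 (fun j ↦ b.repr X (Sum.inr j)))) 2 volume :=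
        (Lp.memLp f).comp_measurePreserving (measurePreserving_add_right volume _)
      refine h1.congr_norm (AEStronglyMeasurable.mul ?_ h1.1) ?_
      · exact (Continuous.aestronglyMeasurable (by fun_prop))
      · filter_upwards with x
        rw [norm_mul, Complex.norm_exp_ofReal_mul_I, one_mul])

/-- The group `Mp^c` of all pairs `(A, U)` of a symplectic automorphism `A` and a unitary operator
`U` on `L²(ℝⁿ)` such that `U W(X) U⁻¹ = W(A X)` for all `X`. It is a central extension of the
symplectic group by `U(1)`. -/
def mpc (Ω : LinearMap.BilinForm ℝ V) (b : Module.Basis (Fin n ⊕ Fin n) ℝ V) :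
    Subgroup ((V ≃ₗ[ℝ] V) × (L2 n ≃ₗᵢ[ℂ] L2 n)) where
  carrier := {a | (∀ X Y, Ω (a.1 X) (a.1 Y) = Ω X Y) ∧
    ∀ X f, a.2 (weyl b X f) = weyl b (a.1 X) (a.2 f)}
  one_mem' := ⟨fun _ _ ↦ rfl, fun _ _ ↦ rfl⟩
  mul_mem' := by
    rintro a a' ⟨h1, h2⟩ ⟨h1', h2'⟩
    refine ⟨fun X Y ↦ ?_, fun X f ↦ ?_⟩
    · change Ω (a.1 (a'.1 X)) (a.1 (a'.1 Y)) = Ω X Y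
      rw [h1, h1']
    · change a.2 (a'.2 (weyl b X f)) = weyl b (a.1 (a'.1 X)) (a.2 (a'.2 f))
      rw [h2', h2]
  inv_mem' := by
    rintro a ⟨h1, h2⟩
    refine ⟨fun X Y ↦ ?_, fun X f ↦ ?_⟩
    · change Ω (a.1.symm X) (a.1.symm Y) = Ω X Y
      rw [← h1]; simp
    · change a.2.symm (weyl b X f) = weyl b (a.1.symm X) (a.2.symm f)
      rw [LinearIsometryEquiv.symm_apply_eq, h2]; simp

/-- The metaplectic group: the commutator subgroup of `Mp^c`. For `n ≥ 1` it is the unique subgroup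
of `Mp^c` that is a twofold covering of the symplectic group, and it is connected; the covering map
is `(A, U) ↦ A`, its kernel is `{1, -1}`, and the metaplectic representation is `(A, U) ↦ U`. -/
def Mp (Ω : LinearMap.BilinForm ℝ V) (b : Module.Basis (Fin n ⊕ Fin n) ℝ V) :
    Subgroup ((V ≃ₗ[ℝ] V) × (L2 n ≃ₗᵢ[ℂ] L2 n)) :=
  ⁅mpc Ω b, mpc Ω b⁆

/-- The covering homomorphism, with values in the linear automorphisms of `V`. -/
def Mp.rho (Ω : LinearMap.BilinForm ℝ V) (b : Module.Basis (Fin n ⊕ Fin n) ℝ V) :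
    Mp Ω b →* (V ≃ₗ[ℝ] V) :=
  (MonoidHom.fst _ _).comp (Mp Ω b).subtype

/-- The metaplectic representation. -/
def Mp.rep (Ω : LinearMap.BilinForm ℝ V) (b : Module.Basis (Fin n ⊕ Fin n) ℝ V) :
    Mp Ω b →* (L2 n ≃ₗᵢ[ℂ] L2 n) :=
  (MonoidHom.snd _ _).comp (Mp Ω b).subtype

theorem Mp.symplectic {Ω : LinearMap.BilinForm ℝ V} {b : Module.Basis (Fin n ⊕ Fin n) ℝ V}
    (a : Mp Ω b) (X Y : V) : Ω (Mp.rho Ω b a X) (Mp.rho Ω b a Y) = Ω X Y :=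
  (Subgroup.commutator_le_self (mpc Ω b) a.2).1 X Y

/-- The topology of the metaplectic group: pointwise convergence of `A` and strong convergence
of `U`. -/
instance [TopologicalSpace V] (Ω : LinearMap.BilinForm ℝ V)
    (b : Module.Basis (Fin n ⊕ Fin n) ℝ V) : TopologicalSpace (Mp Ω b) :=
  TopologicalSpace.induced
    (fun a ↦ ((fun X ↦ Mp.rho Ω b a X : V → V), (fun f ↦ Mp.rep Ω b a f : L2 n → L2 n)))
    inferInstance

end Clifford

/-! ### Associated vector bundles over `G / H` -/

section Associated

variable {G : Type*} [Group G] {H : Subgroup G} {V : Type*} [AddCommGroup V] [Module ℝ V]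

/-- The fibre at `p ∈ G / H` of the vector bundle `G ×_σ V` associated to the principal bundle
`G → G / H`. A vector `[g, v]` is regarded as the `H`-equivariant map from the coset `p` to `V` with
value `v` at `g`; in particular `[g h, v] = [g, σ(h) v]`. -/
def Fibre (σ : H →* (V ≃ₗ[ℝ] V)) (p : G ⧸ H) : Submodule ℝ ({g : G // (g : G ⧸ H) = p} → V) where
  carrier := {v | ∀ (g g' : {g : G // (g : G ⧸ H) = p}) (h : H),
    g'.1 = g.1 * h → v g' = σ h⁻¹ (v g)}
  zero_mem' := fun _ _ _ _ ↦ by simp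
  add_mem' := fun {v w} hv hw g g' h e ↦ by simp [hv g g' h e, hw g g' h e]
  smul_mem' := fun c v hv g g' h e ↦ by simp [hv g g' h e]

/-- For `g ∈ p` the isomorphism `[g, v] ↦ v` from the fibre at `p` to `V`. -/
def evalAt (σ : H →* (V ≃ₗ[ℝ] V)) {p : G ⧸ H} (g : {g : G // (g : G ⧸ H) = p}) :
    Fibre σ p ≃ₗ[ℝ] V where
  toFun v := v.1 g
  map_add' _ _ := rfl
  map_smul' _ _ := rfl
  invFun v := ⟨fun g' ↦ σ ⟨g'.1⁻¹ * g.1, QuotientGroup.eq.mp (g'.2.trans g.2.symm)⟩ v, by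
    intro g₁ g₂ h e
    rw [← LinearEquiv.mul_apply, ← map_mul]
    have : ∀ k k' : H, k = k' → σ k v = σ k' v := by rintro k _ rfl; rfl
    exact this _ _ (Subtype.ext (by simp [e, mul_assoc]))⟩
  left_inv v := by
    ext g'
    symm
    refine (v.2 g g' ⟨g.1⁻¹ * g'.1, QuotientGroup.eq.mp (g.2.trans g'.2.symm)⟩ (by simp)).trans ?_
    congr 2
    exact Subtype.ext (by simp)
  right_inv v := by
    have : (⟨g.1⁻¹ * g.1, QuotientGroup.eq.mp (g.2.trans g.2.symm)⟩ : H) = 1 :=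
      Subtype.ext (by simp)
    change σ _ v = v
    rw [this, map_one]
    rfl

end Associated

/-! ### Symplectic symmetric spaces -/

section LieGroups

variable {E : Type*} [NormedAddCommGroup E] [NormedSpace ℝ E]
  {G : Type*} [TopologicalSpace G] [ChartedSpace E G] [Group G]

/-- The Lie algebra of a closed subgroup `H` of the Lie group `G`: the set of all `X` in the Lie
algebra of `G` whose one-parameter group (the integral curve through `1` of the left-invariant vector
field of `X`) is contained in `H`. This set is a linear subspace if `H` is closed. -/
def subgroupLieAlgebra (H : Subgroup G) : Submodule ℝ (GroupLieAlgebra 𝓘(ℝ, E) G) :=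
  Submodule.span ℝ {X | ∃ γ : ℝ → G, γ 0 = 1 ∧
    IsMIntegralCurve (I := 𝓘(ℝ, E)) γ (mulInvariantVectorField X) ∧ ∀ t, γ t ∈ H}

/-- The adjoint representation `Ad` of `G` on its Lie algebra. -/
def Ad (g : G) (X : GroupLieAlgebra 𝓘(ℝ, E) G) : GroupLieAlgebra 𝓘(ℝ, E) G :=
  mfderiv 𝓘(ℝ, E) 𝓘(ℝ, E) (fun x : G ↦ g * x * g⁻¹) 1 X

/-- The derivative `X(φ)(g) = dφ(dL_g X)` of `φ : G → F` along the left-invariant vector field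
determined by `X`. -/
def leftDeriv {F : Type*} [NormedAddCommGroup F] [NormedSpace ℝ F]
    (X : GroupLieAlgebra 𝓘(ℝ, E) G) (φ : G → F) (g : G) : F :=
  mfderiv 𝓘(ℝ, E) 𝓘(ℝ, F) φ g (mulInvariantVectorField X g)

theorem leftDeriv_eq [LieGroup 𝓘(ℝ, E) ∞ G] {F : Type*} [NormedAddCommGroup F] [NormedSpace ℝ F]
    {φ : G → F} (hφ : MDifferentiable 𝓘(ℝ, E) 𝓘(ℝ, F) φ) (X : GroupLieAlgebra 𝓘(ℝ, E) G) (g : G) :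
    leftDeriv X φ g = mfderiv 𝓘(ℝ, E) 𝓘(ℝ, F) (fun x ↦ φ (g * x)) 1 X := by
  have hg : MDifferentiable 𝓘(ℝ, E) 𝓘(ℝ, E) (fun x : G ↦ g * x) :=
    (contMDiff_mul_left (n := ∞)).mdifferentiable (by simp)
  have h1 := mfderiv_comp_apply (1 : G) (hφ (g * 1)) (hg 1) X
  have hpt : ∀ y : G, y = g → ∀ Y : E,
      (mfderiv 𝓘(ℝ, E) 𝓘(ℝ, F) φ y : E →L[ℝ] F) Y =
      (mfderiv 𝓘(ℝ, E) 𝓘(ℝ, F) φ g : E →L[ℝ] F) Y := by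
    rintro _ rfl Y; rfl
  exact (hpt _ (mul_one g) _).symm.trans h1.symm

end LieGroups

variable (E : Type*) [NormedAddCommGroup E] [NormedSpace ℝ E]
  (G : Type*) [TopologicalSpace G] [ChartedSpace E G] [Group G]

/-- The data defining a symplectic symmetric space `G / H` of dimension `2 n`, where `G` is a Lie
group: a closed connected subgroup `H`, a complement `𝔪` of its Lie algebra `𝔥` such that
`[𝔥, 𝔪] ⊆ 𝔪` and `[𝔪, 𝔪] ⊆ 𝔥`, an `ad(𝔥)`-invariant symplectic form on `𝔪`, and a symplectic basis
`X_1, …, X_n` (`Sum.inl`), `X_{n+1}, …, X_{2n}` (`Sum.inr`) of `𝔪`. -/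
structure SymplecticSymmetricSpace (n : ℕ) where
  H : Subgroup G
  isClosed_H : IsClosed (H : Set G)
  isConnected_H : IsConnected (H : Set G)
  𝔪 : Submodule ℝ (GroupLieAlgebra 𝓘(ℝ, E) G)
  isCompl : IsCompl (subgroupLieAlgebra H) 𝔪
  lie_𝔥_𝔪 : ∀ Z ∈ subgroupLieAlgebra (E := E) H, ∀ X ∈ 𝔪, ⁅Z, X⁆ ∈ 𝔪
  lie_𝔪_𝔪 : ∀ X ∈ 𝔪, ∀ Y ∈ 𝔪, ⁅X, Y⁆ ∈ subgroupLieAlgebra (E := E) H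
  ω₀ : LinearMap.BilinForm ℝ 𝔪
  isAlt : ω₀.IsAlt
  nondegenerate : ω₀.Nondegenerate
  ad_invariant : ∀ (Z : GroupLieAlgebra 𝓘(ℝ, E) G) (hZ : Z ∈ subgroupLieAlgebra (E := E) H)
    (X Y : 𝔪), ω₀ ⟨⁅Z, X.1⁆, lie_𝔥_𝔪 Z hZ X.1 X.2⟩ Y + ω₀ X ⟨⁅Z, Y.1⁆, lie_𝔥_𝔪 Z hZ Y.1 Y.2⟩ = 0
  basis : Module.Basis (Fin n ⊕ Fin n) ℝ 𝔪
  basis_inl_inl : ∀ j k, ω₀ (basis (Sum.inl j)) (basis (Sum.inl k)) = 0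
  basis_inr_inr : ∀ j k, ω₀ (basis (Sum.inr j)) (basis (Sum.inr k)) = 0
  basis_inl_inr : ∀ j k, ω₀ (basis (Sum.inl j)) (basis (Sum.inr k)) = if j = k then 1 else 0

variable {E G} {n : ℕ}

/-- A lift `κ̃ : H → Mp(𝔪)` of the isotropy representation `κ : H → Sp(𝔪)`, where `κ(h)` is the
restriction of `Ad(h)` to `𝔪`. -/
structure Lift (S : SymplecticSymmetricSpace E G n) where
  toHom : S.H →* Mp S.ω₀ S.basis
  continuous_toHom : Continuous toHom
  lifts : ∀ (h : S.H) (X : S.𝔪), (Mp.rho S.ω₀ S.basis (toHom h) X).1 = Ad (E := E) h.1 X.1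

variable {S : SymplecticSymmetricSpace E G n}

namespace Lift

variable (κ' : Lift S)

/-- The isotropy representation `κ = ρ ∘ κ̃` of `H` on `𝔪`. -/
def isotropy : S.H →* (S.𝔪 ≃ₗ[ℝ] S.𝔪) := (Mp.rho S.ω₀ S.basis).comp κ'.toHom

/-- The unitary representation `λ`, the composition of `κ̃` and the metaplectic representation,
regarded as a representation by real linear maps. -/
def spinRep : S.H →* (L2 n ≃ₗ[ℝ] L2 n) where
  toFun h := (Mp.rep S.ω₀ S.basis (κ'.toHom h)).toLinearEquiv.restrictScalars ℝ
  map_one' := by rw [map_one, map_one]; rfl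
  map_mul' h h' := by rw [map_mul, map_mul]; rfl

/-- The tangent space of `G / H` at `p`, the fibre of `G ×_κ 𝔪`. -/
abbrev T (p : G ⧸ S.H) : Type _ := Fibre κ'.isotropy p

/-- The fibre at `p` of the symplectic spinor bundle `Q = G ×_λ L²(ℝⁿ)`. -/
abbrev Q (p : G ⧸ S.H) : Type _ := Fibre κ'.spinRep p

/-- The symplectic form at `p`: `ω([g, X], [g, Y]) = ω₀(X, Y)`. See `omega_apply` for the
independence of `g`. -/
def omega (p : G ⧸ S.H) : LinearMap.BilinForm ℝ (κ'.T p) :=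
  LinearMap.BilinForm.congr (evalAt κ'.isotropy ⟨p.out, p.out_eq⟩).symm S.ω₀

theorem omega_apply {p : G ⧸ S.H} (g : {g : G // (g : G ⧸ S.H) = p}) (v w : κ'.T p) :
    κ'.omega p v w = S.ω₀ (evalAt κ'.isotropy g v) (evalAt κ'.isotropy g w) := by
  have key : ∀ v : κ'.T p, evalAt κ'.isotropy g v = κ'.isotropy
      ⟨p.out⁻¹ * g.1, QuotientGroup.eq.mp (p.out_eq.trans g.2.symm)⟩⁻¹
      (evalAt κ'.isotropy ⟨p.out, p.out_eq⟩ v) := fun v ↦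
    v.2 ⟨p.out, p.out_eq⟩ g ⟨p.out⁻¹ * g.1, QuotientGroup.eq.mp (p.out_eq.trans g.2.symm)⟩
      (by simp)
  rw [key v, key w]
  exact (Mp.symplectic (κ'.toHom _) _ _).symm

theorem omega_nondegenerate (p : G ⧸ S.H) : (κ'.omega p).Nondegenerate :=
  LinearMap.BilinForm.Nondegenerate.congr _ S.nondegenerate

instance (p : G ⧸ S.H) : Module.Finite ℝ (κ'.T p) :=
  have : Module.Finite ℝ S.𝔪 := Module.Finite.of_basis S.basis
  Module.Finite.equiv (evalAt κ'.isotropy ⟨p.out, p.out_eq⟩).symm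

/-- The isomorphism from `T*M` to `TM` generated by `ω`: the image `v` of `α` is characterized
by `ω(v, · ) = α`. -/
def omegaBar (p : G ⧸ S.H) : Module.Dual ℝ (κ'.T p) ≃ₗ[ℝ] κ'.T p :=
  ((κ'.omega p).toDual (κ'.omega_nondegenerate p)).symm

/-- The symplectic Clifford multiplication `μ : TM ⊗ Q → Q` at `p`, an unbounded operator:
`μ([g, X] ⊗ [g, f]) = [g, X · f]` for `g ∈ p`. -/
def mu (p : G ⧸ S.H) : (κ'.T p ⊗[ℝ] κ'.Q p) →ₗ.[ℝ] κ'.Q p :=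
  Submodule.toLinearPMap
    (⨅ g : {g : G // (g : G ⧸ S.H) = p}, (clifford S.basis).graph.comap
      (((TensorProduct.map (evalAt κ'.isotropy g).toLinearMap
        (evalAt κ'.spinRep g).toLinearMap).prodMap (evalAt κ'.spinRep g).toLinearMap)))

theorem mem_graph_mu {p : G ⧸ S.H} (t : κ'.T p ⊗[ℝ] κ'.Q p) (q : κ'.Q p) :
    (t, q) ∈ (κ'.mu p).graph ↔ ∀ g : {g : G // (g : G ⧸ S.H) = p},
      (TensorProduct.map (evalAt κ'.isotropy g).toLinearMap (evalAt κ'.spinRep g).toLinearMap t,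
        evalAt κ'.spinRep g q) ∈ (clifford S.basis).graph := by
  unfold mu
  rw [Submodule.toLinearPMap_graph_eq]
  · simp only [Submodule.mem_iInf, Submodule.mem_comap]
    rfl
  · rintro ⟨t, q⟩ h rfl
    have h' := (Submodule.mem_iInf _).mp h ⟨p.out, p.out_eq⟩
    rw [Submodule.mem_comap, LinearMap.prodMap_apply, map_zero] at h'
    exact (evalAt κ'.spinRep ⟨p.out, p.out_eq⟩).map_eq_zero_iff.mp
      (LinearPMap.graph_fst_eq_zero_snd _ h' rfl)

/-- A symplectic spinor field, i.e. a smooth section of `Q`, viewed as a smooth map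
`φ : G → L²(ℝⁿ)` such that `φ(g h) = λ(h⁻¹) φ(g)`. -/
structure SpinorField where
  toFun : G → L2 n
  smooth : ContMDiff 𝓘(ℝ, E) 𝓘(ℝ, L2 n) ∞ toFun
  equivariant : ∀ (g : G) (h : S.H), toFun (g * h) = κ'.spinRep h⁻¹ (toFun g)

variable {κ'}

theorem SpinorField.leftDeriv_equivariant [LieGroup 𝓘(ℝ, E) ∞ G] (φ : κ'.SpinorField)
    (X : S.𝔪) (g : G) (h : S.H) :
    leftDeriv (E := E) (κ'.isotropy h⁻¹ X).1 φ.toFun (g * h) =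
      κ'.spinRep h⁻¹ (leftDeriv (E := E) X.1 φ.toFun g) := by
  have hφ : MDifferentiable 𝓘(ℝ, E) 𝓘(ℝ, L2 n) φ.toFun := φ.smooth.mdifferentiable (by simp)
  have hX : (κ'.isotropy h⁻¹ X).1 = Ad (E := E) (h⁻¹ : S.H).1 X.1 := κ'.lifts h⁻¹ X
  have hconj : MDifferentiable 𝓘(ℝ, E) 𝓘(ℝ, E)
      (fun x : G ↦ (h⁻¹ : S.H).1 * x * ((h⁻¹ : S.H).1)⁻¹) :=
    ((contMDiff_mul_right (n := ∞)).comp contMDiff_mul_left).mdifferentiable (by simp)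
  rw [leftDeriv_eq hφ, leftDeriv_eq hφ, hX]
  have hφg : ∀ k : G, MDifferentiable 𝓘(ℝ, E) 𝓘(ℝ, L2 n) (fun x ↦ φ.toFun (k * x)) := fun k ↦
    hφ.comp ((contMDiff_mul_left (n := ∞)).mdifferentiable (by simp))
  have h1 := mfderiv_comp_apply (1 : G) (hφg (g * h) _) (hconj 1) X.1
  have hpt : ∀ y : G, y = 1 → ∀ Y : E,
      (mfderiv 𝓘(ℝ, E) 𝓘(ℝ, L2 n) (fun x ↦ φ.toFun (g * h * x)) y : E →L[ℝ] L2 n) Y =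
      (mfderiv 𝓘(ℝ, E) 𝓘(ℝ, L2 n) (fun x ↦ φ.toFun (g * h * x)) 1 : E →L[ℝ] L2 n) Y := by
    rintro _ rfl Y; rfl
  refine ((hpt ((h⁻¹ : S.H).1 * 1 * ((h⁻¹ : S.H).1)⁻¹) (by simp)
    (Ad (E := E) (h⁻¹ : S.H).1 X.1)).symm.trans h1.symm).trans ?_
  have hfun : (fun x ↦ φ.toFun (g * h * x)) ∘
      (fun x : G ↦ (h⁻¹ : S.H).1 * x * ((h⁻¹ : S.H).1)⁻¹) =
      (Mp.rep S.ω₀ S.basis (κ'.toHom h⁻¹)).toContinuousLinearEquiv.toContinuousLinearMap.restrictScalars ℝ ∘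
        (fun x ↦ φ.toFun (g * x)) := by
    funext x
    change φ.toFun (g * h * ((h⁻¹ : S.H).1 * x * ((h⁻¹ : S.H).1)⁻¹)) =
      κ'.spinRep h⁻¹ (φ.toFun (g * x))
    rw [← φ.equivariant]
    congr 1
    simp [mul_assoc]
  rw [hfun]
  have h2 := mfderiv_comp_apply (1 : G) (ContinuousLinearMap.mdifferentiableAt
    ((Mp.rep S.ω₀ S.basis (κ'.toHom h⁻¹)).toContinuousLinearEquiv.toContinuousLinearMap.restrictScalars ℝ))
    (hφg g 1) X.1
  rw [h2, ContinuousLinearMap.mfderiv_eq]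
  rfl

/-- The spinor derivative induced by the canonical connection of the principal bundle `G → G / H`,
whose horizontal space at `g` is `dL_g 𝔪`: for `v = [g, X]`, the derivative of `φ` at `g` along the
horizontal lift `dL_g X` of `v`, i.e. `∇_v φ = [g, dφ(dL_g X)]`. -/
def SpinorField.nabla [LieGroup 𝓘(ℝ, E) ∞ G] (φ : κ'.SpinorField) (p : G ⧸ S.H) :
    κ'.T p →ₗ[ℝ] κ'.Q p where
  toFun v := ⟨fun g ↦ leftDeriv (E := E) (evalAt κ'.isotropy g v).1 φ.toFun g.1, by
    intro g g' h e
    have hv : evalAt κ'.isotropy g' v = κ'.isotropy h⁻¹ (evalAt κ'.isotropy g v) := v.2 g g' h e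
    rw [← φ.leftDeriv_equivariant, ← e, ← hv]⟩
  map_add' v w := by
    ext g : 2
    simp [leftDeriv, mulInvariantVectorField_add]
    rfl
  map_smul' c v := by
    ext g : 2
    simp [leftDeriv, mulInvariantVectorField_smul]
    rfl

/-- `(ω̄ ⊗ id) (∇φ)` at `p`, an element of `T_p M ⊗ Q_p`; here `∇φ` at `p` is regarded as an element
of `T_p^* M ⊗ Q_p = Hom(T_p M, Q_p)`. -/
def SpinorField.omegaBarNabla [LieGroup 𝓘(ℝ, E) ∞ G] (φ : κ'.SpinorField) (p : G ⧸ S.H) :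
    κ'.T p ⊗[ℝ] κ'.Q p :=
  TensorProduct.map (κ'.omegaBar p).toLinearMap LinearMap.id
    ((dualTensorHomEquiv ℝ (κ'.T p) (κ'.Q p)).symm (φ.nabla p))

/-- The domain of the symplectic Dirac operator `𝒟 = μ ∘ (ω̄ ⊗ id) ∘ ∇`: since the Clifford
multiplication `μ` is unbounded, `(ω̄ ⊗ id) (∇φ)` is required to be in the domain of `μ`. -/
def SpinorField.InDiracDomain [LieGroup 𝓘(ℝ, E) ∞ G] (φ : κ'.SpinorField) : Prop :=
  ∀ p, φ.omegaBarNabla p ∈ (κ'.mu p).domain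

/-- The first symplectic Dirac operator `𝒟 = μ ∘ (ω̄ ⊗ id) ∘ ∇`; `𝒟 φ` is a section of `Q`. -/
def SpinorField.dirac [LieGroup 𝓘(ℝ, E) ∞ G] (φ : κ'.SpinorField) (hφ : φ.InDiracDomain)
    (p : G ⧸ S.H) : κ'.Q p :=
  κ'.mu p ⟨φ.omegaBarNabla p, hφ p⟩

/-- A section of `Q`, viewed as a map from `G` to `L²(ℝⁿ)`. -/
def sectionToFun (κ' : Lift S) (s : ∀ p : G ⧸ S.H, κ'.Q p) (g : G) : L2 n :=
  evalAt κ'.spinRep ⟨g, rfl⟩ (s g)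

end Lift

end SymplecticDirac

end

namespace SymplecticDirac

open MeasureTheory

/-! ### The Schrödinger representation on Schwartz functions -/

/-! In the frame `[g, X_k]` of the tangent space, `ω̄` sends the dual vector of `X_{n+j}` to `X_j`
and that of `X_j` to `-X_{n+j}`. Writing `∇φ` as the sum of dual vectors tensored with the
derivatives `X_k(φ)(g)` therefore gives the two sums of the formula before Clifford multiplication
(`SpinorField.omegaBarNabla_eq`). For `φ` in the domain, the formula is the condition defining the
graph of `μ`, read at `g`.

The converse needs more. A value of `μ` is a single vector of the fibre that must represent the
Clifford product at every point of the coset, so the products computed at `g` and at `g h` have to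
correspond under `λ(h⁻¹)`. This is the equivariance `cliffordDist_mpc`: if `X · f = u` is in `L²`,
then `(A X) · (U f) = U u` for every `(A, U)` with `U W(X) U⁻¹ = W(A X)`.

Equivariance holds because Clifford multiplication generates the Weyl operators. Against a Schwartz
function, `W(tX) f` has derivative `W(tX) u` (`hasDerivAt_toDist_weyl_of_cliffordDist`). Since `U`
is not known to preserve Schwartz functions, this is extended to arbitrary test vectors in `L²` by
density and unitarity of `W` (`hasDerivAt_inner_weyl`). Differentiating `U W(tX) f = W(t A X) U f`
weakly at `t = 0` then gives the claim. -/

theorem hasTemperateGrowth_cexp_ofReal_mul_I :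
    Function.HasTemperateGrowth (fun t : ℝ ↦ Complex.exp (t * Complex.I)) := by
  have hd : ∀ m, iteratedDeriv m (fun t : ℝ ↦ Complex.exp (t * Complex.I)) =
      fun t : ℝ ↦ Complex.I ^ m * Complex.exp (t * Complex.I) := by
    intro m
    induction m with
    | zero => simp
    | succ m ih =>
      rw [iteratedDeriv_succ, ih]
      funext t
      have h : HasDerivAt (fun s : ℝ ↦ Complex.exp (s * Complex.I))
          (Complex.exp (t * Complex.I) * (1 * Complex.I)) t :=
        ((Complex.ofRealCLM.hasDerivAt (x := t)).mul_const Complex.I).cexp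
      rw [(h.const_mul (Complex.I ^ m)).deriv]
      ring
  -- All derivatives have modulus one, so growth of degree 0 with constant 1 suffices.
  refine ⟨(Complex.ofRealCLM.contDiff.mul contDiff_const).cexp, fun m ↦ ⟨0, 1, fun t ↦ ?_⟩⟩
  rw [norm_iteratedFDeriv_eq_norm_iteratedDeriv, hd]
  simp [Complex.norm_exp_ofReal_mul_I]

section Schwartz

variable {W : Type*} [NormedAddCommGroup W] [NormedSpace ℝ W]

theorem hasTemperateGrowth_phase (l : W →L[ℝ] ℝ) (c : ℝ) :
    Function.HasTemperateGrowth (fun x : W ↦ Complex.exp (((l x + c : ℝ) : ℂ) * Complex.I)) :=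
  hasTemperateGrowth_cexp_ofReal_mul_I.comp (f := fun x : W ↦ l x + c) (by fun_prop)

theorem hasTemperateGrowth_I_mul (l : W →L[ℝ] ℝ) :
    Function.HasTemperateGrowth (fun x : W ↦ Complex.I * ((l x : ℝ) : ℂ)) := by
  have h : Function.HasTemperateGrowth (fun x : W ↦ ((l x : ℝ) : ℂ)) :=
    (Complex.ofRealCLM ∘L l).hasTemperateGrowth
  exact (Function.HasTemperateGrowth.const Complex.I).mul h

/-- The transpose `ψ ↦ i l ψ - ∂_v ψ` of the infinitesimal Schrödinger representation. -/
noncomputable def schrodingerDeriv (l : W →L[ℝ] ℝ) (v : W) (ψ : 𝓢(W, ℂ)) : 𝓢(W, ℂ) :=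
  SchwartzMap.smulLeftCLM ℂ (fun x : W ↦ Complex.I * ((l x : ℝ) : ℂ)) ψ - ∂_{v} ψ

/-- The transpose `ψ ↦ exp (i (l - l(v) / 2)) ψ(· - v)` of the Weyl operator. -/
noncomputable def weylTranspose (l : W →L[ℝ] ℝ) (v : W) (ψ : 𝓢(W, ℂ)) : 𝓢(W, ℂ) :=
  SchwartzMap.compSubConstCLM ℂ v (SchwartzMap.smulLeftCLM ℂ
    (fun x : W ↦ Complex.exp (((l x + l v / 2 : ℝ) : ℂ) * Complex.I)) ψ)

theorem schrodingerDeriv_apply (l : W →L[ℝ] ℝ) (v : W) (ψ : 𝓢(W, ℂ)) (x : W) :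
    schrodingerDeriv l v ψ x = Complex.I * l x * ψ x - fderiv ℝ ψ x v := by
  simp [schrodingerDeriv, SchwartzMap.smulLeftCLM_apply_apply (hasTemperateGrowth_I_mul l),
    SchwartzMap.lineDerivOp_apply_eq_fderiv]

theorem weylTranspose_apply (l : W →L[ℝ] ℝ) (v : W) (ψ : 𝓢(W, ℂ)) (x : W) :
    weylTranspose l v ψ x =
      Complex.exp (((l (x - v) + l v / 2 : ℝ) : ℂ) * Complex.I) * ψ (x - v) := by
  rw [weylTranspose, SchwartzMap.compSubConstCLM_apply,
    SchwartzMap.smulLeftCLM_apply_apply (hasTemperateGrowth_phase l (l v / 2)), smul_eq_mul]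

theorem norm_weylTranspose_apply (l : W →L[ℝ] ℝ) (v : W) (ψ : 𝓢(W, ℂ)) (x : W) :
    ‖weylTranspose l v ψ x‖ = ‖ψ (x - v)‖ := by
  rw [weylTranspose_apply, norm_mul, Complex.norm_exp_ofReal_mul_I, one_mul]

/-- The derivative of a phase times a Schwartz function along a curve. -/
theorem hasDerivAt_phase_mul_schwartz (ψ : 𝓢(W, ℂ)) {θ : ℝ → ℝ} {θ' : ℝ} {p : ℝ → W} {p' : W}
    {t : ℝ} (hθ : HasDerivAt θ θ' t) (hp : HasDerivAt p p' t) :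
    HasDerivAt (fun s ↦ Complex.exp ((θ s : ℂ) * Complex.I) * ψ (p s))
      (Complex.exp ((θ t : ℂ) * Complex.I) *
        (Complex.I * θ' * ψ (p t) + fderiv ℝ ψ (p t) p')) t := by
  have h1 := (hθ.ofReal_comp.mul_const Complex.I).cexp
  have h2 : HasDerivAt (fun s ↦ ψ (p s)) (fderiv ℝ ψ (p t) p') t :=
    (ψ.differentiableAt (x := p t)).hasFDerivAt.comp_hasDerivAt t hp
  refine (h1.mul h2).congr_deriv ?_
  ring

theorem hasDerivAt_weylTranspose (l : W →L[ℝ] ℝ) (v : W) (ψ : 𝓢(W, ℂ)) (x : W) (t : ℝ) :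
    HasDerivAt (fun s : ℝ ↦ weylTranspose (s • l) (s • v) ψ x)
      (weylTranspose (t • l) (t • v) (schrodingerDeriv l v ψ) x) t := by
  simp only [weylTranspose_apply, schrodingerDeriv_apply]
  have hp : HasDerivAt (fun s : ℝ ↦ x - s • v) (-v) t := by
    simpa using ((hasDerivAt_id t).smul_const v).const_sub x
  -- The phase is `s l(x) - s² l(v) / 2`. The term with the factor one half makes its derivative
  -- exactly `l(x - t v)`, the multiplier at the translated point.
  have hθ : HasDerivAt (fun s : ℝ ↦ (s • l) (x - s • v) + (s • l) (s • v) / 2)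
      (l (x - t • v)) t := by
    have h : HasDerivAt (fun s : ℝ ↦ s * l x - s * s * l v / 2) (1 * l x - (1 * t + t * 1) * l v / 2) t :=
      ((hasDerivAt_id t).mul_const (l x)).sub
        ((((hasDerivAt_id t).mul (hasDerivAt_id t)).mul_const (l v)).div_const 2)
    refine (h.congr_of_eventuallyEq (Filter.Eventually.of_forall fun s ↦ ?_)).congr_deriv ?_
    · simp; ring
    · simp; ring
  refine (hasDerivAt_phase_mul_schwartz ψ hθ hp).congr_deriv ?_
  rw [map_neg, ← sub_eq_add_neg]

/-- A one-parameter group commutes with its generator: differentiating the phase along `v` produces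
`i t l(v)`, which turns the multiplier `i l(x)` into `i l(x - t v)`. -/
theorem schrodingerDeriv_weylTranspose (l : W →L[ℝ] ℝ) (v : W) (ψ : 𝓢(W, ℂ)) (t : ℝ) :
    schrodingerDeriv l v (weylTranspose (t • l) (t • v) ψ) =
      weylTranspose (t • l) (t • v) (schrodingerDeriv l v ψ) := by
  ext x
  have hp : HasDerivAt (fun s : ℝ ↦ x + s • v - t • v) v 0 := by
    simpa using (((hasDerivAt_id (0 : ℝ)).smul_const v).const_add x).sub_const (t • v)
  have hθ : HasDerivAt (fun s : ℝ ↦ (t • l) (x + s • v - t • v) + (t • l) (t • v) / 2)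
      (t * l v) 0 := by
    have h : HasDerivAt (fun s : ℝ ↦ t * (l x + s * l v - t * l v) + t * (t * l v) / 2)
        (t * (1 * l v)) 0 :=
      (((((hasDerivAt_id (0 : ℝ)).mul_const (l v)).const_add (l x)).sub_const _).const_mul
        t).add_const _
    simpa using h
  have h1 := hasDerivAt_phase_mul_schwartz ψ hθ hp
  have h2 : HasDerivAt (fun s : ℝ ↦ weylTranspose (t • l) (t • v) ψ (x + s • v))
      (fderiv ℝ (weylTranspose (t • l) (t • v) ψ) x v) 0 :=
    (weylTranspose (t • l) (t • v) ψ).differentiableAt.hasFDerivAt.hasLineDerivAt v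
  simp only [weylTranspose_apply] at h2
  have h3 := h2.unique h1
  simp only [zero_smul, add_zero] at h3
  rw [schrodingerDeriv_apply, weylTranspose_apply, weylTranspose_apply, schrodingerDeriv_apply, h3]
  simp
  ring

/-- Schwartz decay is uniform under bounded translations. This supplies the dominating function for
differentiating under the integral. -/
theorem exists_weylTranspose_bound (l : W →L[ℝ] ℝ) (v : W) (ψ : 𝓢(W, ℂ)) (R : ℝ) (k : ℕ) :
    ∃ C : ℝ, ∀ (x : W) (t : ℝ), |t| ≤ R →
      ‖weylTranspose (t • l) (t • v) ψ x‖ ≤ C * (1 + ‖x‖) ^ (-k : ℝ) := by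
  obtain ⟨C, hC⟩ : ∃ C : ℝ, ∀ y, (1 + ‖y‖) ^ k * ‖ψ y‖ ≤ C := by
    refine ⟨2 ^ k * (Finset.Iic (k, 0)).sup (fun m ↦ SchwartzMap.seminorm ℝ m.1 m.2) ψ,
      fun y ↦ ?_⟩
    simpa only [norm_iteratedFDeriv_zero] using
      SchwartzMap.one_add_le_sup_seminorm_apply (𝕜 := ℝ) (m := (k, 0)) le_rfl le_rfl ψ y
  refine ⟨(1 + R * ‖v‖) ^ k * C, fun x t ht ↦ ?_⟩
  have hR : 0 ≤ R := (abs_nonneg t).trans ht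
  -- Peetre's inequality, which moves the weight from `x` to the translated point.
  have hx : 1 + ‖x‖ ≤ (1 + R * ‖v‖) * (1 + ‖x - t • v‖) := by
    have h1 : ‖x‖ ≤ ‖x - t • v‖ + ‖t • v‖ := by simpa using norm_add_le (x - t • v) (t • v)
    have h2 : ‖t • v‖ ≤ R * ‖v‖ := by
      rw [norm_smul, Real.norm_eq_abs]
      gcongr
    have h3 : 0 ≤ R * ‖v‖ * ‖x - t • v‖ := by positivity
    linarith
  rw [norm_weylTranspose_apply, Real.rpow_neg (by positivity), Real.rpow_natCast,
    ← div_eq_mul_inv, le_div_iff₀ (by positivity)]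
  calc ‖ψ (x - t • v)‖ * (1 + ‖x‖) ^ k
      ≤ ‖ψ (x - t • v)‖ * ((1 + R * ‖v‖) * (1 + ‖x - t • v‖)) ^ k := by gcongr
    _ = (1 + R * ‖v‖) ^ k * ((1 + ‖x - t • v‖) ^ k * ‖ψ (x - t • v)‖) := by rw [mul_pow]; ring
    _ ≤ (1 + R * ‖v‖) ^ k * C := by gcongr; exact hC _

end Schwartz

/-! ### Weyl operators and the Clifford multiplication -/

theorem toDist_apply {n : ℕ} (f : L2 n) (ψ : 𝓢(EuclideanSpace ℝ (Fin n), ℂ)) :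
    toDist n f ψ = ∫ x, ψ x * f x :=
  Lp.toTemperedDistribution_apply f ψ

/-- Pointwise conjugation is an isometry; continuity makes the conjugates of Schwartz functions
dense as well. -/
theorem continuous_star_L2 (n : ℕ) : Continuous (star : L2 n → L2 n) := by
  refine (Isometry.of_dist_eq fun f g ↦ ?_).continuous
  rw [dist_eq_norm, dist_eq_norm, Lp.norm_def, Lp.norm_def]
  congr 1
  refine eLpNorm_congr_norm_ae ?_
  filter_upwards [Lp.coeFn_sub f g, Lp.coeFn_sub (star f) (star g), Lp.coeFn_star f,
    Lp.coeFn_star g] with x h1 h2 h3 h4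
  rw [h1, h2, Pi.sub_apply, Pi.sub_apply, h3, h4, Pi.star_apply, Pi.star_apply, ← star_sub,
    norm_star]

section Weyl

variable {n : ℕ} {V : Type*} [AddCommGroup V] [Module ℝ V]
  (b : Module.Basis (Fin n ⊕ Fin n) ℝ V)

/-- The linear functional `x ↦ ∑ a_j x_j`, for `X = ∑ a_j X_j + ∑ b_j X_{n+j}`. -/
noncomputable def multiplier : V →ₗ[ℝ] EuclideanSpace ℝ (Fin n) →L[ℝ] ℝ :=
  ∑ j, (b.coord (Sum.inl j)).smulRight (EuclideanSpace.proj j)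

/-- The vector `(b_1, …, b_n)`, for `X = ∑ a_j X_j + ∑ b_j X_{n+j}`. -/
noncomputable def translation : V →ₗ[ℝ] EuclideanSpace ℝ (Fin n) :=
  (WithLp.linearEquiv 2 ℝ (Fin n → ℝ)).symm.toLinearMap ∘ₗ
    LinearMap.pi (fun j ↦ b.coord (Sum.inr j))

theorem multiplier_apply (X : V) (x : EuclideanSpace ℝ (Fin n)) :
    multiplier b X x = ∑ j, b.repr X (Sum.inl j) * x j := by
  simp [multiplier]

theorem translation_apply (X : V) :
    translation b X = WithLp.toLp 2 (fun j ↦ b.repr X (Sum.inr j)) := rfl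

theorem translation_eq_sum (X : V) :
    translation b X = ∑ j, b.repr X (Sum.inr j) • EuclideanSpace.single j (1 : ℝ) := by
  ext k
  simp [translation_apply, Pi.single_apply]

theorem coeFn_weyl (X : V) (f : L2 n) :
    weyl b X f =ᵐ[volume] fun x ↦ Complex.exp (((multiplier b X x
      + multiplier b X (translation b X) / 2 : ℝ) : ℂ) * Complex.I) * f (x + translation b X) := by
  refine (MemLp.coeFn_toLp _).trans (Filter.Eventually.of_forall fun x ↦ ?_)
  simp only [multiplier_apply, translation_apply]

theorem norm_weyl (X : V) (f : L2 n) : ‖weyl b X f‖ = ‖f‖ := by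
  rw [Lp.norm_def, Lp.norm_def]
  congr 1
  have h : eLpNorm (fun x ↦ f (x + translation b X)) 2 volume = eLpNorm f 2 volume :=
    eLpNorm_comp_measurePreserving (Lp.aestronglyMeasurable f)
      (measurePreserving_add_right volume (translation b X))
  rw [← h]
  refine eLpNorm_congr_norm_ae ?_
  filter_upwards [coeFn_weyl b X f] with x hx
  rw [hx, norm_mul, Complex.norm_exp_ofReal_mul_I, one_mul]

/-- Translation invariance of Lebesgue measure moves the shift onto the test function. -/
theorem toDist_weyl (X : V) (f : L2 n) (ψ : 𝓢(EuclideanSpace ℝ (Fin n), ℂ)) :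
    toDist n (weyl b X f) ψ =
      toDist n f (weylTranspose (multiplier b X) (translation b X) ψ) := by
  rw [toDist_apply, toDist_apply, ← integral_add_right_eq_self
    (fun x ↦ weylTranspose (multiplier b X) (translation b X) ψ x * f x) (translation b X)]
  refine integral_congr_ae ?_
  filter_upwards [coeFn_weyl b X f] with x hx
  rw [hx, weylTranspose_apply, add_sub_cancel_right]
  ring

theorem weyl_zero (f : L2 n) : weyl b 0 f = f := by
  refine toDist_injective n ?_
  ext ψ
  rw [toDist_weyl]
  congr 1
  ext x
  simp [weylTranspose_apply]

/-- On distributions, multiplication and differentiation are defined by transposition; the latter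
contributes the minus sign in `schrodingerDeriv`. -/
theorem cliffordDist_apply (X : V) (f : L2 n) (ψ : 𝓢(EuclideanSpace ℝ (Fin n), ℂ)) :
    cliffordDist b (X ⊗ₜ f) ψ =
      toDist n f (schrodingerDeriv (multiplier b X) (translation b X) ψ) := by
  have hD : schrodingerDeriv (multiplier b X) (translation b X) ψ =
      ∑ j, b.repr X (Sum.inl j) • SchwartzMap.smulLeftCLM ℂ
          (fun x : EuclideanSpace ℝ (Fin n) ↦ Complex.I * ((x j : ℝ) : ℂ)) ψ
        + ∑ j, b.repr X (Sum.inr j) • -∂_{EuclideanSpace.single j (1 : ℝ)} ψ := by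
    ext x
    have hg : ∀ j, Function.HasTemperateGrowth
        (fun x : EuclideanSpace ℝ (Fin n) ↦ Complex.I * ((x j : ℝ) : ℂ)) := fun j ↦
      hasTemperateGrowth_I_mul (EuclideanSpace.proj j)
    rw [schrodingerDeriv_apply, multiplier_apply, translation_eq_sum, map_sum]
    simp [SchwartzMap.smulLeftCLM_apply_apply (hg _),
      SchwartzMap.lineDerivOp_apply_eq_fderiv, Finset.mul_sum, Finset.sum_mul, sub_eq_add_neg]
    refine Finset.sum_congr rfl fun j _ ↦ ?_
    ring
  have hsum : cliffordDist b (X ⊗ₜ f) =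
      ∑ j, b.repr X (Sum.inl j) • mulCoord n j f + ∑ j, b.repr X (Sum.inr j) • partialDeriv n j f := by
    simp [cliffordDist, Module.Basis.constr_apply_fintype, Fintype.sum_sum_type,
      LinearMap.sum_apply]
  have hreal : ∀ (c : ℝ) (η : 𝓢(EuclideanSpace ℝ (Fin n), ℂ)),
      toDist n f (c • η) = c * toDist n f η := fun c η ↦ by
    rw [← smul_eq_mul, ← map_smul]
    congr 1
  rw [hsum, hD, map_add, map_sum, map_sum]
  simp only [hreal]
  have hm : ∀ j, mulCoord n j f ψ = toDist n f (SchwartzMap.smulLeftCLM ℂ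
      (fun x : EuclideanSpace ℝ (Fin n) ↦ Complex.I * ((x j : ℝ) : ℂ)) ψ) := fun _ ↦ rfl
  have hp : ∀ j, partialDeriv n j f ψ =
    toDist n f (-∂_{EuclideanSpace.single j (1 : ℝ)} ψ) := fun _ ↦ rfl
  simp [hm, hp]

variable {b}

theorem hasDerivAt_toDist_weyl (X : V) (f : L2 n) (ψ : 𝓢(EuclideanSpace ℝ (Fin n), ℂ)) (t : ℝ) :
    HasDerivAt (fun s : ℝ ↦ toDist n (weyl b (s • X) f) ψ)
      (toDist n (weyl b (t • X) f)
        (schrodingerDeriv (multiplier b X) (translation b X) ψ)) t := by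
  set l := multiplier b X
  set v := translation b X
  have hw : ∀ (s : ℝ) (η : 𝓢(EuclideanSpace ℝ (Fin n), ℂ)), toDist n (weyl b (s • X) f) η =
      ∫ x, weylTranspose (s • l) (s • v) η x * f x := fun s η ↦ by
    rw [toDist_weyl, toDist_apply, map_smul, map_smul]
  simp only [hw]
  -- The exponent `k` is chosen so that `(1 + ‖x‖)^(-k)` is in `L²`; its product with `‖f‖` is then
  -- integrable.
  obtain ⟨k, hk⟩ := (inferInstance : (volume :
    Measure (EuclideanSpace ℝ (Fin n))).HasTemperateGrowth).exists_eLpNorm_lt_top 2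
  -- The bound `|t| + 1` covers all parameters in the unit ball around `t`.
  obtain ⟨C, hC⟩ := exists_weylTranspose_bound l v (schrodingerDeriv l v ψ) (|t| + 1) k
  have hmeas : ∀ η : 𝓢(EuclideanSpace ℝ (Fin n), ℂ),
      AEStronglyMeasurable (fun x ↦ η x * f x) volume := fun η ↦
    η.continuous.aestronglyMeasurable.mul (Lp.aestronglyMeasurable f)
  have hint : ∀ η : 𝓢(EuclideanSpace ℝ (Fin n), ℂ), Integrable (fun x ↦ η x * f x) volume :=
    fun η ↦ (η.memLp 2 volume).integrable_mul (Lp.memLp f)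
  have hbound : Integrable (fun x ↦ C * (1 + ‖x‖) ^ (-k : ℝ) * ‖f x‖) volume := by
    refine MemLp.integrable_mul (p := 2) (q := 2) ?_ (Lp.memLp f).norm
    refine MemLp.const_mul ⟨?_, hk⟩ C
    refine Measurable.aestronglyMeasurable (by fun_prop)
  refine (hasDerivAt_integral_of_dominated_loc_of_deriv_le (Metric.ball_mem_nhds t one_pos)
    (Filter.Eventually.of_forall fun s ↦ hmeas _) (hint _) (hmeas _)
    (Filter.Eventually.of_forall fun x s hs ↦ ?_) hbound
    (Filter.Eventually.of_forall fun x s _ ↦ (hasDerivAt_weylTranspose l v ψ x s).mul_const _)).2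
  rw [norm_mul]
  refine mul_le_mul_of_nonneg_right (hC x s ?_) (norm_nonneg _)
  rw [Metric.mem_ball, Real.dist_eq] at hs
  have := abs_sub_abs_le_abs_sub s t
  linarith

theorem hasDerivAt_toDist_weyl_of_cliffordDist {X : V} {f u : L2 n}
    (h : cliffordDist b (X ⊗ₜ f) = toDist n u) (ψ : 𝓢(EuclideanSpace ℝ (Fin n), ℂ)) (t : ℝ) :
    HasDerivAt (fun s : ℝ ↦ toDist n (weyl b (s • X) f) ψ) (toDist n (weyl b (t • X) u) ψ) t := by
  convert hasDerivAt_toDist_weyl X f ψ t using 1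
  rw [toDist_weyl, toDist_weyl, map_smul, map_smul, ← schrodingerDeriv_weylTranspose,
    ← cliffordDist_apply, h]

/-- The distributional pairing is bilinear while the inner product is conjugate linear in its first
argument, hence the conjugate. -/
theorem toDist_eq_inner (f : L2 n) (ψ : 𝓢(EuclideanSpace ℝ (Fin n), ℂ)) :
    toDist n f ψ = inner ℂ (star (ψ.toLp 2 volume)) f := by
  rw [toDist_apply, L2.inner_def]
  refine integral_congr_ae ?_
  filter_upwards [Lp.coeFn_star (ψ.toLp 2 volume), ψ.coeFn_toLp 2 volume] with x h1 h2
  rw [h1, Pi.star_apply, h2]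
  simp [mul_comm]

/-- Conjugates of Schwartz functions approximate `g`, and the derivatives converge uniformly in the
parameter because `W(sX)` preserves the norm of `u`. -/
theorem hasDerivAt_inner_weyl {X : V} {f u : L2 n}
    (h : cliffordDist b (X ⊗ₜ f) = toDist n u) (g : L2 n) (t : ℝ) :
    HasDerivAt (fun s : ℝ ↦ inner ℂ g (weyl b (s • X) f)) (inner ℂ g (weyl b (t • X) u)) t := by
  have hdense : DenseRange (fun ψ : 𝓢(EuclideanSpace ℝ (Fin n), ℂ) ↦ star (ψ.toLp 2 volume)) :=
    star_involutive.surjective.denseRange.comp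
      (SchwartzMap.denseRange_toLpCLM (F := ℂ) (p := 2) (by simp)) (continuous_star_L2 n)
  obtain ⟨ψ, hψ⟩ : ∃ ψ : ℕ → 𝓢(EuclideanSpace ℝ (Fin n), ℂ), Filter.Tendsto
      (fun k ↦ star ((ψ k).toLp 2 volume)) Filter.atTop (nhds g) := by
    obtain ⟨x, hx, hxg⟩ := mem_closure_iff_seq_limit.mp (hdense g)
    choose ψ hψ using hx
    exact ⟨ψ, by simpa only [hψ] using hxg⟩
  refine hasDerivAt_of_tendstoUniformly (l := Filter.atTop)
    (f := fun k s ↦ inner ℂ (star ((ψ k).toLp 2 volume)) (weyl b (s • X) f))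
    (f' := fun k s ↦ inner ℂ (star ((ψ k).toLp 2 volume)) (weyl b (s • X) u))
    (g' := fun s ↦ inner ℂ g (weyl b (s • X) u)) ?_
    (Filter.Eventually.of_forall fun k s ↦ ?_) (fun s ↦ hψ.inner tendsto_const_nhds) t
  · rw [Metric.tendstoUniformly_iff]
    intro ε hε
    have hz : Filter.Tendsto (fun k ↦ ‖g - star ((ψ k).toLp 2 volume)‖ * ‖u‖) Filter.atTop
        (nhds 0) := by
      simpa using ((tendsto_const_nhds (x := g)).sub hψ).norm.mul_const ‖u‖
    filter_upwards [hz.eventually_lt_const hε] with k hk s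
    rw [dist_eq_norm, ← inner_sub_left]
    refine (norm_inner_le_norm _ _).trans_lt ?_
    rwa [norm_weyl]
  · simp only [← toDist_eq_inner]
    exact hasDerivAt_toDist_weyl_of_cliffordDist h (ψ k) s

/-- Equivariance of the symplectic Clifford multiplication with respect to `Mp^c`. -/
theorem cliffordDist_mpc {Ω : LinearMap.BilinForm ℝ V} {a : (V ≃ₗ[ℝ] V) × (L2 n ≃ₗᵢ[ℂ] L2 n)}
    (ha : a ∈ mpc Ω b) {X : V} {f u : L2 n} (h : cliffordDist b (X ⊗ₜ f) = toDist n u) :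
    cliffordDist b (a.1 X ⊗ₜ a.2 f) = toDist n (a.2 u) := by
  ext ψ
  have h1 := hasDerivAt_toDist_weyl (b := b) (a.1 X) (a.2 f) ψ 0
  -- The test vector is the `U⁻¹`-image of a Schwartz function, known only to be in `L²`. Moving `U`
  -- across the inner product gives a second derivative of the curve in `h1`.
  have h2 := hasDerivAt_inner_weyl h (a.2.symm (star (ψ.toLp 2 volume))) 0
  have key : ∀ w, inner ℂ (a.2.symm (star (ψ.toLp 2 volume))) w = toDist n (a.2 w) ψ := fun w ↦ by
    rw [toDist_eq_inner, ← a.2.inner_map_map, a.2.apply_symm_apply]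
  simp only [key, ha.2, map_smul] at h2
  have h3 := h1.unique h2
  simpa only [zero_smul, weyl_zero, ← cliffordDist_apply] using h3

end Weyl

/-! ### The Dirac operator in a symplectic basis -/

namespace Lift

variable {E : Type*} [NormedAddCommGroup E] [NormedSpace ℝ E]
  {G : Type*} [TopologicalSpace G] [ChartedSpace E G] [Group G] {n : ℕ}
  {S : SymplecticSymmetricSpace E G n}

/-- The basis `[g, X_1], …, [g, X_{2n}]` of the tangent space at `p = g H`. -/
noncomputable def frame (κ' : Lift S) {p : G ⧸ S.H} (g : {g : G // (g : G ⧸ S.H) = p}) :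
    Module.Basis (Fin n ⊕ Fin n) ℝ (κ'.T p) :=
  S.basis.map (evalAt κ'.isotropy g).symm

theorem evalAt_frame (κ' : Lift S) {p : G ⧸ S.H} (g : {g : G // (g : G ⧸ S.H) = p})
    (k : Fin n ⊕ Fin n) : evalAt κ'.isotropy g (κ'.frame g k) = S.basis k := by
  simp [frame]

theorem omega_frame (κ' : Lift S) {p : G ⧸ S.H} (g : {g : G // (g : G ⧸ S.H) = p})
    (k l : Fin n ⊕ Fin n) :
    κ'.omega p (κ'.frame g k) (κ'.frame g l) = S.ω₀ (S.basis k) (S.basis l) := by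
  rw [κ'.omega_apply g, evalAt_frame, evalAt_frame]

theorem basis_inr_inl (S : SymplecticSymmetricSpace E G n) (j k : Fin n) :
    S.ω₀ (S.basis (Sum.inr j)) (S.basis (Sum.inl k)) = if j = k then -1 else 0 := by
  rw [← S.isAlt.neg_eq, S.basis_inl_inr]
  simp only [eq_comm (a := k)]
  split_ifs <;> simp

theorem omegaBar_coord_inr (κ' : Lift S) {p : G ⧸ S.H} (g : {g : G // (g : G ⧸ S.H) = p})
    (j : Fin n) : κ'.omegaBar p ((κ'.frame g).coord (Sum.inr j)) = κ'.frame g (Sum.inl j) := by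
  rw [omegaBar, LinearEquiv.symm_apply_eq]
  refine (κ'.frame g).ext fun k ↦ ?_
  rw [LinearMap.BilinForm.toDual_def, omega_frame]
  rcases k with k | k
  · simp [S.basis_inl_inl]
  · simp [S.basis_inl_inr, Finsupp.single_apply, eq_comm]

theorem omegaBar_coord_inl (κ' : Lift S) {p : G ⧸ S.H} (g : {g : G // (g : G ⧸ S.H) = p})
    (j : Fin n) : κ'.omegaBar p ((κ'.frame g).coord (Sum.inl j)) = -κ'.frame g (Sum.inr j) := by
  rw [omegaBar, LinearEquiv.symm_apply_eq]
  refine (κ'.frame g).ext fun k ↦ ?_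
  rw [LinearMap.BilinForm.toDual_def, map_neg, LinearMap.neg_apply, omega_frame]
  rcases k with k | k
  · simp only [basis_inr_inl, Module.Basis.coord_apply, Module.Basis.repr_self,
      Finsupp.single_apply, Sum.inl.injEq, eq_comm (a := k)]
    split_ifs <;> simp
  · simp [S.basis_inr_inr]

variable {κ' : Lift S}

/-- Equivariance of the symplectic Clifford multiplication under the structure group `H`. -/
theorem cliffordDist_spinRep (h : S.H) {X : S.𝔪} {f u : L2 n}
    (hu : cliffordDist S.basis (X ⊗ₜ f) = toDist n u) :
    cliffordDist S.basis (κ'.isotropy h X ⊗ₜ κ'.spinRep h f) = toDist n (κ'.spinRep h u) :=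
  cliffordDist_mpc (Subgroup.commutator_le_self _ (κ'.toHom h).2) hu

/-- Vectors of `T_p M ⊗ Q_p` whose Clifford product is in `L²(ℝⁿ)` termwise, with respect to one
point of the coset `p`, are in the domain of `μ`. -/
theorem mem_graph_mu_of_sum {ι : Type*} (s : Finset ι) {p : G ⧸ S.H}
    (g : {g : G // (g : G ⧸ S.H) = p}) (v : ι → κ'.T p) (q r : ι → κ'.Q p)
    (h : ∀ i ∈ s, cliffordDist S.basis (evalAt κ'.isotropy g (v i) ⊗ₜ evalAt κ'.spinRep g (q i)) =
      toDist n (evalAt κ'.spinRep g (r i))) :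
    (∑ i ∈ s, v i ⊗ₜ[ℝ] q i, ∑ i ∈ s, r i) ∈ (κ'.mu p).graph := by
  rw [mem_graph_mu]
  intro g'
  rw [mem_graph_clifford, map_sum, map_sum, map_sum, map_sum]
  refine Finset.sum_congr rfl fun i hi ↦ ?_
  -- Passing from `g` to `g' = g k` acts on all evaluations by `k⁻¹`, so equivariance transports
  -- each product.
  let k : S.H := ⟨g.1⁻¹ * g'.1, QuotientGroup.eq.mp (g.2.trans g'.2.symm)⟩
  have hk : g'.1 = g.1 * k := by simp [k]
  have hv : evalAt κ'.isotropy g' (v i) = κ'.isotropy k⁻¹ (evalAt κ'.isotropy g (v i)) :=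
    (v i).2 g g' k hk
  have hQ : ∀ w : κ'.Q p, evalAt κ'.spinRep g' w = κ'.spinRep k⁻¹ (evalAt κ'.spinRep g w) :=
    fun w ↦ w.2 g g' k hk
  rw [TensorProduct.map_tmul, LinearEquiv.coe_coe, LinearEquiv.coe_coe, hv, hQ, hQ]
  exact cliffordDist_spinRep k⁻¹ (h i hi)

variable [LieGroup 𝓘(ℝ, E) ∞ G]

theorem SpinorField.omegaBarNabla_eq (φ : κ'.SpinorField) {p : G ⧸ S.H}
    (g : {g : G // (g : G ⧸ S.H) = p}) :
    φ.omegaBarNabla p =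
      ∑ j, κ'.frame g (Sum.inl j) ⊗ₜ[ℝ] φ.nabla p (κ'.frame g (Sum.inr j))
      - ∑ j, κ'.frame g (Sum.inr j) ⊗ₜ[ℝ] φ.nabla p (κ'.frame g (Sum.inl j)) := by
  -- A linear map on a finite-dimensional space is the sum of the dual basis vectors tensored with
  -- its values on the basis.
  have h : (dualTensorHomEquiv ℝ (κ'.T p) (κ'.Q p)).symm (φ.nabla p) =
      ∑ k, (κ'.frame g).coord k ⊗ₜ[ℝ] φ.nabla p (κ'.frame g k) := by
    rw [LinearEquiv.symm_apply_eq, map_sum]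
    refine (κ'.frame g).ext fun k ↦ ?_
    rcases k with k | k <;> simp [LinearMap.sum_apply, Finsupp.single_apply, ite_smul]
  rw [omegaBarNabla, h, map_sum, Fintype.sum_sum_type]
  simp only [TensorProduct.map_tmul, LinearEquiv.coe_coe, LinearMap.id_apply, omegaBar_coord_inl,
    omegaBar_coord_inr, TensorProduct.neg_tmul]
  rw [add_comm, sub_eq_add_neg]
  congr 1
  exact Finset.sum_neg_distrib (G := κ'.T p ⊗[ℝ] κ'.Q p) _

theorem SpinorField.map_evalAt_omegaBarNabla (φ : κ'.SpinorField) {p : G ⧸ S.H}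
    (g : {g : G // (g : G ⧸ S.H) = p}) :
    TensorProduct.map (evalAt κ'.isotropy g).toLinearMap (evalAt κ'.spinRep g).toLinearMap
        (φ.omegaBarNabla p) =
      ∑ j, S.basis (Sum.inl j) ⊗ₜ[ℝ] leftDeriv (E := E) (S.basis (Sum.inr j)).1 φ.toFun g.1
      - ∑ j, S.basis (Sum.inr j) ⊗ₜ[ℝ]
          leftDeriv (E := E) (S.basis (Sum.inl j)).1 φ.toFun g.1 := by
  have hn : ∀ k, evalAt κ'.spinRep g (φ.nabla p (κ'.frame g k)) =
      leftDeriv (E := E) (S.basis k).1 φ.toFun g.1 := fun k ↦ by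
    rw [← evalAt_frame κ' g k]; rfl
  rw [φ.omegaBarNabla_eq g, map_sub, map_sum, map_sum]
  simp only [TensorProduct.map_tmul, LinearEquiv.coe_coe, evalAt_frame, hn]

theorem SpinorField.inDiracDomain_of_mem (φ : κ'.SpinorField)
    (h₁ : ∀ (j : Fin n) (g : G), S.basis (Sum.inl j) ⊗ₜ[ℝ]
      leftDeriv (E := E) (S.basis (Sum.inr j)).1 φ.toFun g ∈ (clifford S.basis).domain)
    (h₂ : ∀ (j : Fin n) (g : G), S.basis (Sum.inr j) ⊗ₜ[ℝ]
      leftDeriv (E := E) (S.basis (Sum.inl j)).1 φ.toFun g ∈ (clifford S.basis).domain) :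
    φ.InDiracDomain := by
  intro p
  -- One representative suffices, since `mem_graph_mu_of_sum` carries the products to the rest of
  -- the coset.
  let g : {g : G // (g : G ⧸ S.H) = p} := ⟨p.out, p.out_eq⟩
  have hn : ∀ k, evalAt κ'.spinRep g (φ.nabla p (κ'.frame g k)) =
      leftDeriv (E := E) (S.basis k).1 φ.toFun g.1 := fun k ↦ by
    rw [← evalAt_frame κ' g k]; rfl
  rw [φ.omegaBarNabla_eq g]
  refine @Submodule.sub_mem ℝ (κ'.T p ⊗[ℝ] κ'.Q p) _ _ _ (κ'.mu p).domain _ _ ?_ ?_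
  · refine LinearPMap.mem_domain_of_mem_graph (mem_graph_mu_of_sum Finset.univ g _ _
      (fun j ↦ (evalAt κ'.spinRep g).symm (clifford S.basis ⟨_, h₁ j g.1⟩)) fun j _ ↦ ?_)
    rw [LinearEquiv.apply_symm_apply, toDist_clifford, evalAt_frame, hn]
  · refine LinearPMap.mem_domain_of_mem_graph (mem_graph_mu_of_sum Finset.univ g _ _
      (fun j ↦ (evalAt κ'.spinRep g).symm (clifford S.basis ⟨_, h₂ j g.1⟩)) fun j _ ↦ ?_)
    rw [LinearEquiv.apply_symm_apply, toDist_clifford, evalAt_frame, hn]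

theorem SpinorField.toDist_dirac (φ : κ'.SpinorField) (hφ : φ.InDiracDomain) (g : G) :
    toDist n (κ'.sectionToFun (φ.dirac hφ) g) =
      ∑ j : Fin n, cliffordDist S.basis (S.basis (Sum.inl j) ⊗ₜ[ℝ]
        leftDeriv (E := E) (S.basis (Sum.inr j)).1 φ.toFun g)
      - ∑ j : Fin n, cliffordDist S.basis (S.basis (Sum.inr j) ⊗ₜ[ℝ]
        leftDeriv (E := E) (S.basis (Sum.inl j)).1 φ.toFun g) := by
  have h := (κ'.mem_graph_mu _ _).mp ((κ'.mu (g : G ⧸ S.H)).mem_graph ⟨_, hφ g⟩) ⟨g, rfl⟩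
  rw [mem_graph_clifford, φ.map_evalAt_omegaBarNabla, map_sub, map_sum, map_sum] at h
  exact h.symm

end Lift

end SymplecticDirac

theorem mainTheorem9
    {E : Type*} [NormedAddCommGroup E] [NormedSpace ℝ E] [FiniteDimensional ℝ E]
    {G : Type*} [TopologicalSpace G] [ChartedSpace E G] [Group G] [LieGroup 𝓘(ℝ, E) ∞ G]
    [T2Space G] [SecondCountableTopology G] [SimplyConnectedSpace G]
    {n : ℕ} (S : SymplecticDirac.SymplecticSymmetricSpace E G n) (κ' : SymplecticDirac.Lift S)
    (φ : κ'.SpinorField) :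
    (∀ (hφ : φ.InDiracDomain) (g : G),
      SymplecticDirac.toDist n (κ'.sectionToFun (φ.dirac hφ) g) =
        ∑ j : Fin n, SymplecticDirac.cliffordDist S.basis
          (S.basis (Sum.inl j) ⊗ₜ[ℝ]
            SymplecticDirac.leftDeriv (E := E) (S.basis (Sum.inr j)).1 φ.toFun g)
        - ∑ j : Fin n, SymplecticDirac.cliffordDist S.basis
          (S.basis (Sum.inr j) ⊗ₜ[ℝ]
            SymplecticDirac.leftDeriv (E := E) (S.basis (Sum.inl j)).1 φ.toFun g)) ∧
    (∀ (h₁ : ∀ (j : Fin n) (g : G), S.basis (Sum.inl j) ⊗ₜ[ℝ]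
          SymplecticDirac.leftDeriv (E := E) (S.basis (Sum.inr j)).1 φ.toFun g ∈
            (SymplecticDirac.clifford S.basis).domain)
        (h₂ : ∀ (j : Fin n) (g : G), S.basis (Sum.inr j) ⊗ₜ[ℝ]
          SymplecticDirac.leftDeriv (E := E) (S.basis (Sum.inl j)).1 φ.toFun g ∈
            (SymplecticDirac.clifford S.basis).domain),
      ∃ hφ : φ.InDiracDomain, ∀ g : G,
        κ'.sectionToFun (φ.dirac hφ) g =
          ∑ j : Fin n, SymplecticDirac.clifford S.basis ⟨_, h₁ j g⟩
          - ∑ j : Fin n, SymplecticDirac.clifford S.basis ⟨_, h₂ j g⟩) := by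
  refine ⟨φ.toDist_dirac, fun h₁ h₂ ↦ ⟨φ.inDiracDomain_of_mem h₁ h₂, fun g ↦ ?_⟩⟩
  -- Since `L²` embeds in the tempered distributions, the distributional formula already implies the
  -- identity in `L²`.
  refine SymplecticDirac.toDist_injective n ?_
  rw [φ.toDist_dirac, map_sub, map_sum, map_sum]
  simp only [SymplecticDirac.toDist_clifford]
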